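/- Let $n\ge 0$. A Boolean space is a Hausdorff space whose compact-open sets form a base; $\mathsf{BS}$ is the category of Boolean spaces and continuous maps under which preimages of compact sets are compact. A left-handed skew Boolean algebra is an algebra $(S;\wedge,\vee,\setminus,0)$ such that: $\wedge,\vee$ are associative and idempotent; $x\wedge(x\vee y)=x=x\vee(x\wedge y)$ and $(y\vee x)\wedge x=x=(y\wedge x)\vee x$; $x\wedge y=y\wedge x$ if and only if $x\vee y=y\vee x$; $x\wedge 0=0=0\wedge x$; $x\wedge y\wedge x=x\wedge y$ and $x\vee y\vee x=y\vee x$; and, with $y\le x$ meaning $x\wedge y=y=y\wedge x$, each $\lceil x\rceil=\{y: y\le x\}$ is a Boolean lattice in which $x\setminus y$ is the complement of $x\wedge y\wedge x$. Write $x\,\mathcal D\,y$ if $x\wedge y\wedge x=x$ and $y\wedge x\wedge y=y$; this is a congruence. $\mathsf{Skew}$ is the category of left-handed skew Boolean algebras and those homomorphisms $\varphi:S\to T$ (preserving $\wedge,\vee,\setminus,0$) that are proper: for each $b\in T$ there is $a\in S$ with $[b]\le[\varphi(a)]$ in $T/\mathcal D$. Let $\mathbf{n+2}$ be the left-handed skew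 Boolean algebra on $\{0,\dots,n+1\}$ with zero $0$ and $x\wedge y=x$, $x\vee y=y$ for $x,y\ne 0$. For a Boolean space $X$, let $\lambda_n(X)$ be the algebra, with pointwise operations, of all continuous $f:X\to\mathbf{n+2}$ (discrete topology) for which $f^{-1}(1),\dots,f^{-1}(n+1)$ are compact; for $g:X_1\to X_2$ in $\mathsf{BS}$ let $\lambda_n(g):\lambda_n(X_2)\to\lambda_n(X_1)$ be $f\mapsto f\circ g$. For $S$ in $\mathsf{Skew}$, let $\Lambda_n(S)$ be the set of all morphisms $S\to\mathbf{n+2}$ in $\mathsf{Skew}$ with the topology induced from the product space $\{0,\dots,n+1\}^S$; for $h:S_1\to S_2$ let $\Lambda_n(h):\Lambda_n(S_2)\to\Lambda_n(S_1)$ be $f\mapsto f\circ h$. These are functors $\lambda_n:\mathsf{BS}^{op}\to\mathsf{Skew}$ and $\Lambda_n:\mathsf{Skew}\to\mathsf{BS}^{op}$. Let $\lambda_n(\mathsf{BS})$ be the category whose objects are the algebras $\lambda_n(X)$, $X$ a Boolean space (the space $X$, the common domain of the elements of $\lambda_n(X)$, being regarded as part of the object), and whose arrows are the $\lambda_n(f)$,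 $f$ a morphism of Boolean spaces. Then $\lambda_n(\mathsf{BS})$ is a (not necessarily full) reflective subcategory of $\mathsf{Skew}$, with reflector $\lambda_n\Lambda_n$. That is, the inclusion functor $\lambda_n(\mathsf{BS})\to\mathsf{Skew}$ is faithful, and it has a left adjoint, namely $\lambda_n\Lambda_n$ regarded as a functor $\mathsf{Skew}\to\lambda_n(\mathsf{BS})$; the composite of this left adjoint with the inclusion is $\lambda_n\Lambda_n:\mathsf{Skew}\to\mathsf{Skew}$. -/

import Mathlib

open CategoryTheory Topology

universe u v w

/-- A skew lattice: two associative idempotent operations satisfying the four absorption laws. -/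
class SkewLattice (S : Type u) where
  meet : S → S → S
  join : S → S → S
  meet_assoc : ∀ x y z : S, meet (meet x y) z = meet x (meet y z)
  join_assoc : ∀ x y z : S, join (join x y) z = join x (join y z)
  meet_idem : ∀ x : S, meet x x = x
  join_idem : ∀ x : S, join x x = x
  meet_join_self : ∀ x y : S, meet x (join x y) = x
  join_meet_self : ∀ x y : S, join x (meet x y) = x
  join_meet_right : ∀ x y : S, meet (join y x) x = x
  meet_join_right : ∀ x y : S, join (meet y x) x = x

infixl:70 " ⋏ " => SkewLattice.meet
infixl:65 " ⋎ " => SkewLattice.join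

/-- The natural partial order of a skew lattice. -/
def SkewLattice.NatLE {S : Type u} [SkewLattice S] (x y : S) : Prop :=
  x ⋏ y = x ∧ y ⋏ x = x

/-- The relation `𝒟` of a skew lattice. -/
def SkewLattice.DRel {S : Type u} [SkewLattice S] (x y : S) : Prop :=
  x ⋏ y ⋏ x = x ∧ y ⋏ x ⋏ y = y

/-- Left-handed skew Boolean algebras, in the signature `(⋏, ⋎, \, 0)`: left-handed symmetric
skew lattices with zero all of whose principal subalgebras `⌈x⌉ = {y | y ≤ x}` are Boolean
lattices, where `x \ y` is the complement of `x ⋏ y ⋏ x` in `⌈x⌉`. (Since `y = x ⋏ y ⋏ x` for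
`y ≤ x`, the last three laws provide a complement in `⌈x⌉` of each element of `⌈x⌉`. Commutativity
of `⋎` on `⌈x⌉` follows from that of `⋏` by symmetry.) -/
class LeftSkewBooleanAlgebra (S : Type u) extends SkewLattice S where
  zero : S
  sdiff : S → S → S
  symmetric : ∀ x y : S, x ⋏ y = y ⋏ x ↔ x ⋎ y = y ⋎ x
  meet_left_handed : ∀ x y : S, x ⋏ y ⋏ x = x ⋏ y
  join_left_handed : ∀ x y : S, x ⋎ y ⋎ x = y ⋎ x
  meet_zero : ∀ x : S, x ⋏ zero = zero
  zero_meet : ∀ x : S, zero ⋏ x = zero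
  principal_meet_comm : ∀ x y z : S, SkewLattice.NatLE y x → SkewLattice.NatLE z x →
    y ⋏ z = z ⋏ y
  principal_distrib : ∀ x y z t : S, SkewLattice.NatLE y x → SkewLattice.NatLE z x →
    SkewLattice.NatLE t x → y ⋏ (z ⋎ t) = (y ⋏ z) ⋎ (y ⋏ t)
  sdiff_le : ∀ x y : S, SkewLattice.NatLE (sdiff x y) x
  meet_sdiff : ∀ x y : S, (x ⋏ y ⋏ x) ⋏ sdiff x y = zero
  join_sdiff : ∀ x y : S, (x ⋏ y ⋏ x) ⋎ sdiff x y = x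

/-- Proper homomorphisms of left-handed skew Boolean algebras. Properness of `φ` means that the
homomorphism `S/𝒟 → T/𝒟` induced by `φ` is proper: for each `b : T` there is `a : S` with
`[b] ≤ [φ a]` in `T/𝒟`, that is, `[b ⋏ φ a] = [b] ⋏ [φ a] = [b]`. -/
@[ext]
structure ProperHom (S : Type u) (T : Type v) [LeftSkewBooleanAlgebra S]
    [LeftSkewBooleanAlgebra T] where
  toFun : S → T
  map_meet : ∀ x y : S, toFun (x ⋏ y) = toFun x ⋏ toFun y
  map_join : ∀ x y : S, toFun (x ⋎ y) = toFun x ⋎ toFun y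
  map_sdiff : ∀ x y : S, toFun (LeftSkewBooleanAlgebra.sdiff x y) =
    LeftSkewBooleanAlgebra.sdiff (toFun x) (toFun y)
  map_zero : toFun LeftSkewBooleanAlgebra.zero = LeftSkewBooleanAlgebra.zero
  proper : ∀ b : T, ∃ a : S, SkewLattice.DRel (b ⋏ toFun a) b

theorem dRel_meet_iff {S : Type u} [LeftSkewBooleanAlgebra S] (b c : S) :
    SkewLattice.DRel (b ⋏ c) b ↔ b ⋏ c = b := by
  have h1 : b ⋏ c ⋏ b = b ⋏ c := LeftSkewBooleanAlgebra.meet_left_handed b c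
  unfold SkewLattice.DRel
  rw [h1]
  constructor
  · rintro ⟨-, h⟩
    rwa [← SkewLattice.meet_assoc, SkewLattice.meet_idem, h1] at h
  · intro h
    rw [h]
    exact ⟨SkewLattice.meet_idem b, by rw [SkewLattice.meet_idem, SkewLattice.meet_idem]⟩

/-- The identity homomorphism. -/
def ProperHom.id (S : Type u) [LeftSkewBooleanAlgebra S] : ProperHom S S where
  toFun x := x
  map_meet _ _ := rfl
  map_join _ _ := rfl
  map_sdiff _ _ := rfl
  map_zero := rfl
  proper b := ⟨b, (dRel_meet_iff _ _).2 (SkewLattice.meet_idem b)⟩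

/-- Composition of proper homomorphisms. -/
def ProperHom.comp {S : Type u} {T : Type v} {R : Type w} [LeftSkewBooleanAlgebra S]
    [LeftSkewBooleanAlgebra T] [LeftSkewBooleanAlgebra R]
    (g : ProperHom T R) (f : ProperHom S T) : ProperHom S R where
  toFun x := g.toFun (f.toFun x)
  map_meet x y := by rw [f.map_meet, g.map_meet]
  map_join x y := by rw [f.map_join, g.map_join]
  map_sdiff x y := by rw [f.map_sdiff, g.map_sdiff]
  map_zero := by rw [f.map_zero, g.map_zero]
  proper c := by
    obtain ⟨b, hb⟩ := g.proper c
    obtain ⟨a, ha⟩ := f.proper b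
    rw [dRel_meet_iff] at hb ha
    refine ⟨a, (dRel_meet_iff _ _).2 ?_⟩
    have h := congrArg g.toFun ha
    rw [g.map_meet] at h
    calc c ⋏ g.toFun (f.toFun a) = c ⋏ g.toFun b ⋏ g.toFun (f.toFun a) := by rw [hb]
      _ = c := by rw [SkewLattice.meet_assoc, h, hb]

/-- The category `Skew` of left-handed skew Boolean algebras and proper homomorphisms. -/
structure Skew : Type (u + 1) where
  of ::
  carrier : Type u
  [str : LeftSkewBooleanAlgebra carrier]

attribute [instance] Skew.str

instance : Category.{u} Skew.{u} where
  Hom S T := ProperHom S.carrier T.carrier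
  id S := ProperHom.id S.carrier
  comp f g := ProperHom.comp g f

/-- Proper continuous maps: preimages of compact sets are compact. -/
@[ext]
structure ProperMap (X : Type u) (Y : Type v) [TopologicalSpace X] [TopologicalSpace Y] where
  toFun : X → Y
  continuous : Continuous toFun
  isCompact_preimage : ∀ K : Set Y, IsCompact K → IsCompact (toFun ⁻¹' K)

/-- The category `BS` of (locally compact) Boolean spaces, that is, Hausdorff spaces in which
the compact open sets form a base, and proper continuous maps. -/
structure BS : Type (u + 1) where
  of ::
  carrier : Type u
  [top : TopologicalSpace carrier]
  [t2 : T2Space carrier]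
  [base : PrespectralSpace carrier]

attribute [instance] BS.top BS.t2 BS.base

instance : Category.{u} BS.{u} where
  Hom X Y := ProperMap X.carrier Y.carrier
  id X := ⟨fun x => x, continuous_id, fun _ h => h⟩
  comp f g := ⟨fun x => g.toFun (f.toFun x), g.continuous.comp f.continuous,
    fun K hK => f.isCompact_preimage _ (g.isCompact_preimage K hK)⟩

/-- The set `{0, 1, …, n + 1}` underlying the primitive algebra `𝐧+𝟐`. -/
def Prim (n : ℕ) : Type := Fin (n + 2)

instance (n : ℕ) : DecidableEq (Prim n) := inferInstanceAs (DecidableEq (Fin (n + 2)))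
instance (n : ℕ) : Finite (Prim n) := inferInstanceAs (Finite (Fin (n + 2)))
instance (n : ℕ) : Zero (Prim n) := inferInstanceAs (Zero (Fin (n + 2)))
instance (n : ℕ) : One (Prim n) := inferInstanceAs (One (Fin (n + 2)))
instance (n : ℕ) : NeZero (1 : Prim n) := inferInstanceAs (NeZero (1 : Fin (n + 2)))
instance (n : ℕ) : TopologicalSpace (Prim n) := ⊥
instance (n : ℕ) : DiscreteTopology (Prim n) := ⟨rfl⟩

instance (n : ℕ) : SkewLattice (Prim n) where
  meet x y := if y = 0 then 0 else x
  join x y := if y = 0 then x else y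
  meet_assoc x y z := by by_cases hx : x = 0 <;> by_cases hy : y = 0 <;> by_cases hz : z = 0 <;> simp [*]
  join_assoc x y z := by by_cases hx : x = 0 <;> by_cases hy : y = 0 <;> by_cases hz : z = 0 <;> simp [*]
  meet_idem x := by by_cases hx : x = 0 <;> simp [*]
  join_idem x := by by_cases hx : x = 0 <;> simp [*]
  meet_join_self x y := by by_cases hx : x = 0 <;> by_cases hy : y = 0 <;> simp [*]
  join_meet_self x y := by by_cases hx : x = 0 <;> by_cases hy : y = 0 <;> simp [*]
  join_meet_right x y := by by_cases hx : x = 0 <;> by_cases hy : y = 0 <;> simp [*]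
  meet_join_right x y := by by_cases hx : x = 0 <;> by_cases hy : y = 0 <;> simp [*]

theorem Prim.meet_def {n : ℕ} (x y : Prim n) : x ⋏ y = if y = 0 then 0 else x := rfl
theorem Prim.join_def {n : ℕ} (x y : Prim n) : x ⋎ y = if y = 0 then x else y := rfl

/-- The primitive left-handed skew Boolean algebra `𝐧+𝟐`: for nonzero `x` and `y` one has
`x ⋏ y = x` and `x ⋎ y = y`. -/
instance (n : ℕ) : LeftSkewBooleanAlgebra (Prim n) where
  zero := 0
  sdiff x y := if y = 0 then x else 0
  symmetric x y := by
    by_cases hx : x = 0 <;> by_cases hy : y = 0 <;> simp [*, Prim.meet_def, Prim.join_def, eq_comm]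
  meet_left_handed x y := by
    by_cases hx : x = 0 <;> by_cases hy : y = 0 <;> simp [*, Prim.meet_def]
  join_left_handed x y := by
    by_cases hx : x = 0 <;> by_cases hy : y = 0 <;> simp [*, Prim.join_def]
  meet_zero x := by simp [Prim.meet_def]
  zero_meet x := by simp [Prim.meet_def]
  principal_meet_comm x y z hy hz := by
    simp only [SkewLattice.NatLE, Prim.meet_def] at *
    grind
  principal_distrib x y z t hy hz ht := by
    simp only [SkewLattice.NatLE, Prim.meet_def, Prim.join_def] at *
    grind
  sdiff_le x y := by
    by_cases hx : x = 0 <;> by_cases hy : y = 0 <;> simp [*, Prim.meet_def, SkewLattice.NatLE]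
  meet_sdiff x y := by
    by_cases hx : x = 0 <;> by_cases hy : y = 0 <;> simp [*, Prim.meet_def]
  join_sdiff x y := by
    by_cases hx : x = 0 <;> by_cases hy : y = 0 <;> simp [*, Prim.meet_def, Prim.join_def]

theorem Prim.sdiff_def {n : ℕ} (x y : Prim n) :
    LeftSkewBooleanAlgebra.sdiff x y = if y = 0 then x else 0 := rfl
theorem Prim.zero_def {n : ℕ} : (LeftSkewBooleanAlgebra.zero : Prim n) = 0 := rfl

/-- The set `λₙ(X)` of continuous maps `f : X → {0, …, n + 1}` for which the sets
`f⁻¹(1), …, f⁻¹(n + 1)` are compact. -/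
@[ext]
structure LamSet (n : ℕ) (X : Type u) [TopologicalSpace X] where
  toFun : X → Prim n
  continuous : Continuous toFun
  isCompact_fiber : ∀ i : Prim n, i ≠ 0 → IsCompact (toFun ⁻¹' {i})

/-- The operation on `λₙ(X)` induced pointwise by an operation on `{0, …, n + 1}`. -/
def LamSet.pointwise {n : ℕ} {X : Type u} [TopologicalSpace X] (op : Prim n → Prim n → Prim n)
    (h0 : op 0 0 = 0) (f g : LamSet n X) : LamSet n X where
  toFun x := op (f.toFun x) (g.toFun x)
  continuous := by
    have h : Continuous fun p : Prim n × Prim n => op p.1 p.2 := continuous_of_discreteTopology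
    exact h.comp (f.continuous.prodMk g.continuous)
  isCompact_fiber i hi := by
    have hc : Continuous fun x => op (f.toFun x) (g.toFun x) := by
      have h : Continuous fun p : Prim n × Prim n => op p.1 p.2 := continuous_of_discreteTopology
      exact h.comp (f.continuous.prodMk g.continuous)
    have hK : IsCompact ((⋃ j ∈ {j : Prim n | j ≠ 0}, f.toFun ⁻¹' {j}) ∪
        ⋃ j ∈ {j : Prim n | j ≠ 0}, g.toFun ⁻¹' {j}) :=
      ((Set.toFinite _).isCompact_biUnion fun j hj => f.isCompact_fiber j hj).union
        ((Set.toFinite _).isCompact_biUnion fun j hj => g.isCompact_fiber j hj)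
    refine hK.of_isClosed_subset ((isClosed_discrete {i}).preimage hc) ?_
    intro x hx
    have hx' : op (f.toFun x) (g.toFun x) = i := hx
    by_cases hf : f.toFun x = 0
    · refine Or.inr (Set.mem_biUnion (x := g.toFun x) ?_ rfl)
      intro hg
      apply hi
      rw [← hx', hf, hg, h0]
    · exact Or.inl (Set.mem_biUnion (x := f.toFun x) hf rfl)

instance (n : ℕ) (X : Type u) [TopologicalSpace X] : SkewLattice (LamSet n X) where
  meet := LamSet.pointwise (fun x y => x ⋏ y) (SkewLattice.meet_idem 0)
  join := LamSet.pointwise (fun x y => x ⋎ y) (SkewLattice.join_idem 0)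
  meet_assoc _ _ _ := LamSet.ext (funext fun _ => SkewLattice.meet_assoc _ _ _)
  join_assoc _ _ _ := LamSet.ext (funext fun _ => SkewLattice.join_assoc _ _ _)
  meet_idem _ := LamSet.ext (funext fun _ => SkewLattice.meet_idem _)
  join_idem _ := LamSet.ext (funext fun _ => SkewLattice.join_idem _)
  meet_join_self _ _ := LamSet.ext (funext fun _ => SkewLattice.meet_join_self _ _)
  join_meet_self _ _ := LamSet.ext (funext fun _ => SkewLattice.join_meet_self _ _)
  join_meet_right _ _ := LamSet.ext (funext fun _ => SkewLattice.join_meet_right _ _)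
  meet_join_right _ _ := LamSet.ext (funext fun _ => SkewLattice.meet_join_right _ _)

theorem LamSet.meet_apply {n : ℕ} {X : Type u} [TopologicalSpace X] (f g : LamSet n X) (x : X) :
    (f ⋏ g).toFun x = f.toFun x ⋏ g.toFun x := rfl
theorem LamSet.join_apply {n : ℕ} {X : Type u} [TopologicalSpace X] (f g : LamSet n X) (x : X) :
    (f ⋎ g).toFun x = f.toFun x ⋎ g.toFun x := rfl

theorem LamSet.natLE_apply {n : ℕ} {X : Type u} [TopologicalSpace X] {f g : LamSet n X}
    (h : SkewLattice.NatLE f g) (x : X) : SkewLattice.NatLE (f.toFun x) (g.toFun x) :=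
  ⟨congrFun (congrArg LamSet.toFun h.1) x, congrFun (congrArg LamSet.toFun h.2) x⟩

instance (n : ℕ) (X : Type u) [TopologicalSpace X] : LeftSkewBooleanAlgebra (LamSet n X) where
  zero := ⟨fun _ => 0, continuous_const, fun i hi => by
    have h : (fun _ : X => (0 : Prim n)) ⁻¹' {i} = ∅ := by
      ext x
      simpa using hi.symm
    rw [h]
    exact isCompact_empty⟩
  sdiff := LamSet.pointwise LeftSkewBooleanAlgebra.sdiff (by simp [Prim.sdiff_def])
  symmetric f g := by
    constructor
    · intro h
      refine LamSet.ext (funext fun x => ?_)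
      exact (LeftSkewBooleanAlgebra.symmetric _ _).1 (congrFun (congrArg LamSet.toFun h) x)
    · intro h
      refine LamSet.ext (funext fun x => ?_)
      exact (LeftSkewBooleanAlgebra.symmetric _ _).2 (congrFun (congrArg LamSet.toFun h) x)
  meet_left_handed _ _ := LamSet.ext (funext fun _ => LeftSkewBooleanAlgebra.meet_left_handed _ _)
  join_left_handed _ _ := LamSet.ext (funext fun _ => LeftSkewBooleanAlgebra.join_left_handed _ _)
  meet_zero _ := LamSet.ext (funext fun _ => LeftSkewBooleanAlgebra.meet_zero _)
  zero_meet _ := LamSet.ext (funext fun _ => LeftSkewBooleanAlgebra.zero_meet _)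
  principal_meet_comm _ _ _ hy hz := LamSet.ext (funext fun a =>
    LeftSkewBooleanAlgebra.principal_meet_comm _ _ _ (LamSet.natLE_apply hy a)
      (LamSet.natLE_apply hz a))
  principal_distrib _ _ _ _ hy hz ht := LamSet.ext (funext fun a =>
    LeftSkewBooleanAlgebra.principal_distrib _ _ _ _ (LamSet.natLE_apply hy a)
      (LamSet.natLE_apply hz a) (LamSet.natLE_apply ht a))
  sdiff_le _ _ := ⟨LamSet.ext (funext fun _ => (LeftSkewBooleanAlgebra.sdiff_le _ _).1),
    LamSet.ext (funext fun _ => (LeftSkewBooleanAlgebra.sdiff_le _ _).2)⟩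
  meet_sdiff _ _ := LamSet.ext (funext fun _ => LeftSkewBooleanAlgebra.meet_sdiff _ _)
  join_sdiff _ _ := LamSet.ext (funext fun _ => LeftSkewBooleanAlgebra.join_sdiff _ _)

theorem LamSet.isCompact_support {n : ℕ} {X : Type u} [TopologicalSpace X] (f : LamSet n X) :
    IsCompact {x | f.toFun x ≠ 0} := by
  have h : {x | f.toFun x ≠ 0} = ⋃ j ∈ {j : Prim n | j ≠ 0}, f.toFun ⁻¹' {j} := by
    ext x
    simp
  rw [h]
  exact (Set.toFinite _).isCompact_biUnion fun j hj => f.isCompact_fiber j hj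

open Classical in
/-- The element of `λₙ(X)` with value `1` on a compact open set and `0` elsewhere. -/
noncomputable def LamSet.indicator (n : ℕ) {X : Type u} [TopologicalSpace X] [T2Space X]
    (K : Set X) (hK : IsCompact K) (hK' : IsOpen K) : LamSet n X where
  toFun x := if x ∈ K then 1 else 0
  continuous := by
    refine continuous_discrete_rng.2 fun i => ?_
    have h : (fun x => if x ∈ K then (1 : Prim n) else 0) ⁻¹' {i} =
        {x | x ∈ K ∧ 1 = i} ∪ {x | x ∈ Kᶜ ∧ 0 = i} := by
      ext x
      by_cases hx : x ∈ K <;> simp [hx]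
    rw [h]
    exact (hK'.and isOpen_const).union (hK.isClosed.isOpen_compl.and isOpen_const)
  isCompact_fiber i hi := by
    have h : (fun x => if x ∈ K then (1 : Prim n) else 0) ⁻¹' {i} = K ∩ {_x | 1 = i} := by
      ext x
      by_cases hx : x ∈ K <;> simp [hx, hi.symm]
    rw [h]
    exact hK.inter_right isClosed_const

theorem LamSet.indicator_apply_ne_zero (n : ℕ) {X : Type u} [TopologicalSpace X] [T2Space X]
    (K : Set X) (hK : IsCompact K) (hK' : IsOpen K) {x : X} (hx : x ∈ K) :
    (LamSet.indicator n K hK hK').toFun x ≠ 0 := by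
  simp [LamSet.indicator, hx]

theorem exists_isCompact_isOpen_superset {X : Type u} [TopologicalSpace X] [PrespectralSpace X]
    (C : Set X) (hC : IsCompact C) : ∃ K, IsCompact K ∧ IsOpen K ∧ C ⊆ K := by
  refine hC.induction_on ⟨∅, isCompact_empty, isOpen_empty, subset_rfl⟩ ?_ ?_ ?_
  · rintro s t hst ⟨K, h1, h2, h3⟩
    exact ⟨K, h1, h2, hst.trans h3⟩
  · rintro s t ⟨K, h1, h2, h3⟩ ⟨L, h4, h5, h6⟩
    exact ⟨K ∪ L, h1.union h4, h2.union h5, Set.union_subset_union h3 h6⟩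
  · intro x _
    obtain ⟨K, ⟨hK, hK'⟩, hx, -⟩ :=
      PrespectralSpace.isTopologicalBasis.exists_subset_of_mem_open (Set.mem_univ x) isOpen_univ
    exact ⟨K, mem_nhdsWithin_of_mem_nhds (hK.mem_nhds hx), K, hK', hK, subset_rfl⟩

/-- The action of `λₙ` on morphisms: `f ↦ f ∘ g`. -/
def LamSet.precomp (n : ℕ) {X : Type u} {Y : Type v} [TopologicalSpace X]
    [TopologicalSpace Y] [T2Space X] [PrespectralSpace X] (g : ProperMap Y X) :
    ProperHom (LamSet n X) (LamSet n Y) where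
  toFun f := ⟨fun y => f.toFun (g.toFun y), f.continuous.comp g.continuous,
    fun i hi => g.isCompact_preimage _ (f.isCompact_fiber i hi)⟩
  map_meet _ _ := rfl
  map_join _ _ := rfl
  map_sdiff _ _ := rfl
  map_zero := rfl
  proper b := by
    obtain ⟨K, hK, hK', hsub⟩ :=
      exists_isCompact_isOpen_superset _ (b.isCompact_support.image g.continuous)
    refine ⟨LamSet.indicator n K hK hK', (dRel_meet_iff _ _).2 (LamSet.ext (funext fun y => ?_))⟩
    rw [LamSet.meet_apply, Prim.meet_def]
    by_cases hy : b.toFun y = 0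
    · rw [hy, ite_self]
    · rw [if_neg]
      exact LamSet.indicator_apply_ne_zero n K hK hK' (hsub ⟨y, hy, rfl⟩)

/-- The functor `λₙ : BSᵒᵖ ⥤ Skew`. -/
def lam (n : ℕ) : BS.{u}ᵒᵖ ⥤ Skew.{u} where
  obj X := Skew.of (LamSet n X.unop.carrier)
  map g := LamSet.precomp n g.unop

/-- The topology on the set `Λₙ(S)` of all proper homomorphisms `S → 𝐧+𝟐` induced by the product
topology on `{0, …, n + 1}^S`. -/
instance (n : ℕ) (S : Type u) [LeftSkewBooleanAlgebra S] :
    TopologicalSpace (ProperHom S (Prim n)) :=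
  TopologicalSpace.induced ProperHom.toFun inferInstance

theorem LamSpace.isEmbedding (n : ℕ) (S : Type u) [LeftSkewBooleanAlgebra S] :
    IsEmbedding (ProperHom.toFun : ProperHom S (Prim n) → S → Prim n) :=
  ⟨⟨rfl⟩, fun _ _ h => ProperHom.ext h⟩

theorem LamSpace.continuous_apply {n : ℕ} {S : Type u} [LeftSkewBooleanAlgebra S] (s : S) :
    Continuous fun f : ProperHom S (Prim n) => f.toFun s :=
  (_root_.continuous_apply s).comp (LamSpace.isEmbedding n S).continuous

instance (n : ℕ) (S : Type u) [LeftSkewBooleanAlgebra S] : T2Space (ProperHom S (Prim n)) :=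
  (LamSpace.isEmbedding n S).t2Space

theorem LamSpace.isOpen_fiber {n : ℕ} {S : Type u} [LeftSkewBooleanAlgebra S] (s : S)
    (i : Prim n) : IsOpen {f : ProperHom S (Prim n) | f.toFun s = i} :=
  (isOpen_discrete {i}).preimage (LamSpace.continuous_apply s)

theorem LamSpace.isCompact_fiber {n : ℕ} {S : Type u} [LeftSkewBooleanAlgebra S] (s : S)
    (i : Prim n) (hi : i ≠ 0) : IsCompact {f : ProperHom S (Prim n) | f.toFun s = i} := by
  rw [(LamSpace.isEmbedding n S).isCompact_iff]
  have h2 (op : Prim n → Prim n → Prim n) (x y z : S) :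
      IsClosed {f : S → Prim n | f z = op (f x) (f y)} := by
    have h : Continuous fun p : Prim n × Prim n => op p.1 p.2 := continuous_of_discreteTopology
    exact isClosed_eq (_root_.continuous_apply z)
      (Continuous.comp (f := fun f : S → Prim n => (f x, f y)) h
        ((_root_.continuous_apply x).prodMk (_root_.continuous_apply y)))
  have h0 (x : S) (j : Prim n) : IsClosed {f : S → Prim n | f x = j} :=
    isClosed_eq (_root_.continuous_apply x) continuous_const
  have hC : IsClosed
      ((⋂ (x : S) (y : S), {f : S → Prim n | f (x ⋏ y) = f x ⋏ f y}) ∩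
      (⋂ (x : S) (y : S), {f : S → Prim n | f (x ⋎ y) = f x ⋎ f y}) ∩
      (⋂ (x : S) (y : S), {f : S → Prim n | f (LeftSkewBooleanAlgebra.sdiff x y) =
        LeftSkewBooleanAlgebra.sdiff (f x) (f y)}) ∩
      {f : S → Prim n | f LeftSkewBooleanAlgebra.zero = LeftSkewBooleanAlgebra.zero} ∩
      {f : S → Prim n | f s = i}) :=
    ((((isClosed_iInter fun x => isClosed_iInter fun y => h2 _ x y _).inter
      (isClosed_iInter fun x => isClosed_iInter fun y => h2 _ x y _)).inter
      (isClosed_iInter fun x => isClosed_iInter fun y => h2 _ x y _)).inter (h0 _ _)).inter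
      (h0 _ _)
  convert hC.isCompact using 1
  ext f
  simp only [Set.mem_image, Set.mem_ofPred_eq, Set.mem_inter_iff, Set.mem_iInter]
  constructor
  · rintro ⟨g, hg, rfl⟩
    exact ⟨⟨⟨⟨g.map_meet, g.map_join⟩, g.map_sdiff⟩, g.map_zero⟩, hg⟩
  · rintro ⟨⟨⟨⟨hm, hj⟩, hd⟩, hz⟩, hs⟩
    refine ⟨⟨f, hm, hj, hd, hz, fun b => ⟨s, (dRel_meet_iff _ _).2 ?_⟩⟩, hs, rfl⟩
    rw [hs, Prim.meet_def, if_neg hi]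

theorem LamSpace.exists_ne_zero {n : ℕ} {S : Type u} [LeftSkewBooleanAlgebra S]
    (f : ProperHom S (Prim n)) : ∃ s : S, f.toFun s ≠ 0 := by
  obtain ⟨s, hs⟩ := f.proper 1
  refine ⟨s, fun h => ?_⟩
  rw [dRel_meet_iff, h, Prim.meet_def, if_pos rfl] at hs
  exact zero_ne_one hs

instance (n : ℕ) (S : Type u) [LeftSkewBooleanAlgebra S] :
    PrespectralSpace (ProperHom S (Prim n)) := by
  refine ⟨TopologicalSpace.isTopologicalBasis_of_isOpen_of_nhds (fun U hU => hU.1) ?_⟩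
  intro f U hf hU
  obtain ⟨s, hs⟩ := LamSpace.exists_ne_zero f
  obtain ⟨V, hV, rfl⟩ := (LamSpace.isEmbedding n S).isOpen_iff.1 hU
  obtain ⟨T, t, ht, hsub⟩ := isOpen_pi_iff.1 hV f.toFun hf
  have hcl : IsClopen (⋂ x ∈ T, {g : ProperHom S (Prim n) | g.toFun x = f.toFun x}) :=
    ⟨isClosed_biInter fun x _ => (isClosed_discrete {f.toFun x}).preimage
        (LamSpace.continuous_apply x),
      isOpen_biInter_finset fun x _ => LamSpace.isOpen_fiber x _⟩
  refine ⟨{g | g.toFun s = f.toFun s} ∩ ⋂ x ∈ T, {g | g.toFun x = f.toFun x},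
    ⟨(LamSpace.isOpen_fiber _ _).inter hcl.2, (LamSpace.isCompact_fiber _ _ hs).inter_right hcl.1⟩,
    ⟨rfl, by simp⟩, ?_⟩
  rintro g ⟨-, hg⟩
  refine hsub fun x hx => ?_
  have hgx : g.toFun x = f.toFun x := by simpa using Set.mem_iInter₂.1 hg x hx
  rw [hgx]
  exact (ht x hx).2

/-- The action of `Λₙ` on morphisms: `f ↦ f ∘ h`. -/
def LamSpace.precomp (n : ℕ) {S : Type u} {T : Type v} [LeftSkewBooleanAlgebra S]
    [LeftSkewBooleanAlgebra T] (h : ProperHom S T) :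
    ProperMap (ProperHom T (Prim n)) (ProperHom S (Prim n)) where
  toFun f := f.comp h
  continuous := (LamSpace.isEmbedding n S).continuous_iff.2
    (continuous_pi fun s => LamSpace.continuous_apply (h.toFun s))
  isCompact_preimage K hK := by
    have hc : Continuous fun f : ProperHom T (Prim n) => f.comp h :=
      (LamSpace.isEmbedding n S).continuous_iff.2
        (continuous_pi fun s => LamSpace.continuous_apply (h.toFun s))
    have key : ∃ C : Set (ProperHom S (Prim n)), K ⊆ C ∧
        IsCompact ((fun f : ProperHom T (Prim n) => f.comp h) ⁻¹' C) := by
      refine hK.induction_on ⟨∅, subset_rfl, isCompact_empty⟩ ?_ ?_ ?_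
      · rintro s t hst ⟨C, h1, h2⟩
        exact ⟨C, hst.trans h1, h2⟩
      · rintro s t ⟨C, h1, h2⟩ ⟨D, h3, h4⟩
        exact ⟨C ∪ D, Set.union_subset_union h1 h3, h2.union h4⟩
      · intro f _
        obtain ⟨s, hs⟩ := LamSpace.exists_ne_zero f
        exact ⟨_, mem_nhdsWithin_of_mem_nhds ((LamSpace.isOpen_fiber s (f.toFun s)).mem_nhds rfl),
          _, subset_rfl, LamSpace.isCompact_fiber (h.toFun s) _ hs⟩
    obtain ⟨C, hKC, hC⟩ := key
    exact hC.of_isClosed_subset (hK.isClosed.preimage hc) (Set.preimage_mono hKC)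

/-- The functor `Λₙ : Skew ⥤ BSᵒᵖ`. -/
def Lam (n : ℕ) : Skew.{u} ⥤ BS.{u}ᵒᵖ where
  obj S := Opposite.op (BS.of (ProperHom S.carrier (Prim n)))
  map h := Quiver.Hom.op (LamSpace.precomp n h)

/-- The category `λₙ(BS)`. The objects are the algebras `λₙ(X)`, `X` a Boolean space; such an
object is recorded by the space `X`, which in set theory is determined by the set `λₙ(X)`, being
the common domain of its elements. The arrows `λₙ(X) ⟶ λₙ(Y)` are the homomorphisms of the form
`λₙ(f)`, where `f : Y ⟶ X` is a morphism of Boolean spaces. -/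
structure LamBS (n : ℕ) : Type (u + 1) where
  space : BS.{u}

/-- The algebra `λₙ(X)`. -/
def LamBS.toSkew {n : ℕ} (A : LamBS.{u} n) : Skew.{u} := (lam n).obj (Opposite.op A.space)

instance (n : ℕ) : Category.{u} (LamBS.{u} n) where
  Hom A B := {h : A.toSkew ⟶ B.toSkew // ∃ f : B.space ⟶ A.space, (lam n).map f.op = h}
  id A := ⟨𝟙 A.toSkew, 𝟙 A.space, (lam n).map_id _⟩
  comp h k := ⟨h.1 ≫ k.1, by
    obtain ⟨f, hf⟩ := h.2
    obtain ⟨g, hg⟩ := k.2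
    refine ⟨g ≫ f, ?_⟩
    rw [← hf, ← hg, op_comp]
    exact (lam n).map_comp f.op g.op⟩

/-- The inclusion functor `λₙ(BS) ⥤ Skew`. -/
def LamBS.incl (n : ℕ) : LamBS.{u} n ⥤ Skew.{u} where
  obj A := A.toSkew
  map h := h.1

/-- The functor `λₙΛₙ`, regarded as a functor `Skew ⥤ λₙ(BS)`. -/
def LamBS.reflector (n : ℕ) : Skew.{u} ⥤ LamBS.{u} n where
  obj S := ⟨((Lam n).obj S).unop⟩
  map h := ⟨(lam n).map ((Lam n).map h), ((Lam n).map h).unop, rfl⟩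
  map_id S := Subtype.ext ((Lam n ⋙ lam n).map_id S)
  map_comp h k := Subtype.ext ((Lam n ⋙ lam n).map_comp h k)

/-! A homomorphism `S → λₙ(X)` and a map `X → Λₙ(S)` are two readings of one function `S × X → {0,
…, n + 1}`. The operations of `λₙ(X)` are pointwise and the topology of `Λₙ(S)` is that of pointwise
convergence, so algebraic laws and continuity pass through the exchange of arguments; only
properness needs an argument.

Both nontrivial cases, the unit `LamSpace.eval` and the map `LamSet.transpose`, rest on
`LamSpace.exists_forall_ne_zero`: a single element of `S` is nonzero throughout a given compact
subset of `Λₙ(S)`. That each point of `X` yields a proper homomorphism to `𝐧+𝟐` rests on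
`LamSet.exists_apply_ne_zero`.

The restriction of arrows to those of the form `λₙ(f)` gives uniqueness in the universal property:
composing `λₙ(f)` with the unit sends `s` to `x ↦ (f x)(s)`, which determines `f`. -/

/-! ### Nonvanishing on compact sets and the unit -/

theorem Prim.join_ne_zero {n : ℕ} {x y : Prim n} : x ⋎ y ≠ 0 ↔ x ≠ 0 ∨ y ≠ 0 := by
  rw [Prim.join_def]
  by_cases hy : y = 0 <;> simp [hy]

/-- By properness each point of `Λₙ(S)` is nonzero at some `s`, and then so are all points of an
open neighbourhood. Compactness leaves finitely many such `s`, and their join works everywhere,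
since a join in `𝐧+𝟐` vanishes only when both arguments do. -/
theorem LamSpace.exists_forall_ne_zero {n : ℕ} {S : Type u} [LeftSkewBooleanAlgebra S]
    {C : Set (ProperHom S (Prim n))} (hC : IsCompact C) : ∃ s : S, ∀ f ∈ C, f.toFun s ≠ 0 := by
  refine hC.induction_on ⟨LeftSkewBooleanAlgebra.zero, by simp⟩ ?_ ?_ ?_
  · rintro C D hCD ⟨s, hs⟩
    exact ⟨s, fun f hf => hs f (hCD hf)⟩
  · rintro C D ⟨s, hs⟩ ⟨t, ht⟩
    refine ⟨s ⋎ t, fun f hf => ?_⟩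
    rw [f.map_join, Prim.join_ne_zero]
    exact hf.imp (hs f) (ht f)
  · intro f _
    obtain ⟨s, hs⟩ := LamSpace.exists_ne_zero f
    refine ⟨_, mem_nhdsWithin_of_mem_nhds ((LamSpace.isOpen_fiber s (f.toFun s)).mem_nhds rfl),
      s, fun g hg => ?_⟩
    have hg' : g.toFun s = f.toFun s := hg
    rwa [hg']

/-- The evaluation homomorphism `S → λₙ(Λₙ(S))`, the unit of the reflection. -/
def LamSpace.eval (n : ℕ) (S : Type u) [LeftSkewBooleanAlgebra S] :
    ProperHom S (LamSet n (ProperHom S (Prim n))) where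
  toFun s := ⟨fun f => f.toFun s, LamSpace.continuous_apply s,
    fun i hi => LamSpace.isCompact_fiber s i hi⟩
  map_meet s t := LamSet.ext (funext fun f => f.map_meet s t)
  map_join s t := LamSet.ext (funext fun f => f.map_join s t)
  map_sdiff s t := LamSet.ext (funext fun f => f.map_sdiff s t)
  map_zero := LamSet.ext (funext fun f => f.map_zero)
  proper b := by
    -- In `𝐧+𝟐` one has `x ⋏ y = x` whenever `y ≠ 0`, so an `s` that is nonzero on the whole support
    -- of `b` dominates `b` modulo `𝒟`, whatever its nonzero values are.
    obtain ⟨s, hs⟩ := LamSpace.exists_forall_ne_zero b.isCompact_support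
    refine ⟨s, (dRel_meet_iff _ _).2 (LamSet.ext (funext fun f => ?_))⟩
    rw [LamSet.meet_apply, Prim.meet_def]
    by_cases hf : b.toFun f = 0
    · rw [hf, ite_self]
    · exact if_neg (hs f hf)

/-! ### Transposition of homomorphisms into `λₙ(X)` -/

/-- Compact open sets cover `X`, so some indicator is nonzero at `x`. This keeps evaluation at `x`
from being the zero map, which is not proper. -/
theorem LamSet.exists_apply_ne_zero (n : ℕ) {X : Type u} [TopologicalSpace X] [T2Space X]
    [PrespectralSpace X] (x : X) : ∃ b : LamSet n X, b.toFun x ≠ 0 := by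
  obtain ⟨K, hK, hK', hx⟩ := exists_isCompact_isOpen_superset {x} isCompact_singleton
  exact ⟨_, LamSet.indicator_apply_ne_zero n K hK hK' (Set.singleton_subset_iff.1 hx)⟩

/-- Evaluation at a point, composed with a proper homomorphism into `λₙ(X)`. -/
def LamSet.evalAt {n : ℕ} {S : Type u} {X : Type v} [LeftSkewBooleanAlgebra S]
    [TopologicalSpace X] [T2Space X] [PrespectralSpace X] (φ : ProperHom S (LamSet n X)) (x : X) :
    ProperHom S (Prim n) where
  toFun s := (φ.toFun s).toFun x
  map_meet s t := by rw [φ.map_meet]; rfl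
  map_join s t := by rw [φ.map_join]; rfl
  map_sdiff s t := by rw [φ.map_sdiff]; rfl
  map_zero := by rw [φ.map_zero]; rfl
  proper i := by
    -- The choice of `b` ignores `i`: any one nonzero value dominates all of `𝐧+𝟐`. An image `φ(s)`
    -- dominating `b` cannot vanish at `x`, since `b` does not.
    obtain ⟨b, hb⟩ := LamSet.exists_apply_ne_zero n x
    obtain ⟨s, hs⟩ := φ.proper b
    refine ⟨s, (dRel_meet_iff _ _).2 ?_⟩
    have h := congrFun (congrArg LamSet.toFun ((dRel_meet_iff _ _).1 hs)) x
    rw [LamSet.meet_apply, Prim.meet_def] at h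
    rw [Prim.meet_def]
    refine if_neg fun h0 => hb ?_
    rw [← h, if_pos h0]

/-- The proper map `X → Λₙ(S)` corresponding to a proper homomorphism `S → λₙ(X)`. -/
def LamSet.transpose {n : ℕ} {S : Type u} {X : Type v} [LeftSkewBooleanAlgebra S]
    [TopologicalSpace X] [T2Space X] [PrespectralSpace X] (φ : ProperHom S (LamSet n X)) :
    ProperMap X (ProperHom S (Prim n)) where
  toFun := LamSet.evalAt φ
  continuous := (LamSpace.isEmbedding n S).continuous_iff.2
    (continuous_pi fun s => (φ.toFun s).continuous)
  isCompact_preimage K hK := by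
    have hc : Continuous (LamSet.evalAt φ) := (LamSpace.isEmbedding n S).continuous_iff.2
      (continuous_pi fun s => (φ.toFun s).continuous)
    -- With `s` nonzero on all of `K`, the preimage of `K` is a closed subset of the compact support
    -- of `φ(s)`.
    obtain ⟨s, hs⟩ := LamSpace.exists_forall_ne_zero hK
    exact (φ.toFun s).isCompact_support.of_isClosed_subset (hK.isClosed.preimage hc)
      fun x hx => hs _ hx

/-! ### The reflection -/

/-- The bijection between `λₙ(BS)`-arrows `λₙ(Λₙ(S)) → A` and proper homomorphisms `S → A`. -/
def LamBS.homEquiv (n : ℕ) (S : Skew.{u}) (A : LamBS.{u} n) :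
    ((LamBS.reflector n).obj S ⟶ A) ≃ (S ⟶ (LamBS.incl n).obj A) where
  toFun h := ProperHom.comp h.1 (LamSpace.eval n S.carrier)
  invFun φ := ⟨LamSet.precomp n (LamSet.transpose φ), LamSet.transpose φ, rfl⟩
  left_inv := by
    -- Every arrow here is some `λₙ(f)`; transposing `λₙ(f) ∘ eval` sends `x` to `s ↦ (f x)(s)`,
    -- which is `f x` itself.
    rintro ⟨_, f, rfl⟩
    rfl
  right_inv _ := rfl

/-- The reflector is left adjoint to the inclusion. -/
def LamBS.adjunction (n : ℕ) : LamBS.reflector.{u} n ⊣ LamBS.incl.{u} n :=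
  Adjunction.mkOfHomEquiv
    { homEquiv := LamBS.homEquiv n
      homEquiv_naturality_left_symm := fun _ _ => rfl
      homEquiv_naturality_right := fun _ _ => rfl }

theorem mainTheorem6 (n : ℕ) :
    (LamBS.incl.{u} n).Faithful ∧
      LamBS.reflector.{u} n ⋙ LamBS.incl.{u} n = Lam.{u} n ⋙ lam.{u} n ∧
      Nonempty (LamBS.reflector.{u} n ⊣ LamBS.incl.{u} n) :=
  ⟨⟨fun h => Subtype.ext h⟩, rfl, ⟨LamBS.adjunction n⟩⟩
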